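/- Let $0<\varepsilon<2^{-22}$. There exists $n_0=n_0(\varepsilon)$ such that the following holds for every $n\ge n_0$. Let $H$ be a finite $3$-partite $3$-graph with partition classes $V_1,V_2,V_3$ (every edge is a set of vertices meeting each $V_i$ in exactly one vertex), where $|V_1|=|V_2|=|V_3|=n$, and let $\delta_1(H)$ be the minimum, over all vertices $v$, of the number of edges containing $v$. Suppose that there are sets $W_i\subseteq V_i$ with $|W_i|=\lfloor (n+i-1)/3\rfloor$ for $i=1,2,3$ such that $H$ is $\varepsilon$-close to the corresponding graph $H'_3(n;n)$, that is, $$|E(H'_3(n;n))\setminus E(H)|\le \varepsilon n^3,$$ where, with $W=W_1\cup W_2\cup W_3$, $H'_3(n;n)$ is the $3$-partite $3$-graph on the same classes whose edges are all triples with exactly one vertex in each $V_i$ that contain at least one vertex of $W$ and at least one vertex outside $W$. Suppose also that $$\delta_1(H)>\begin{cases}(5n^2-6n)/9 & \text{if } n\equiv 0 \pmod 3,\\ (5n^2-4n-1)/9 & \text{if } n\equiv 1 \pmod 3,\\ (5n^2-8n+5)/9 & \text{if } n\equiv 2 \pmod 3.\end{cases}$$ Then $H$ has a perfect matching, i.e.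 a set of pairwise disjoint edges covering all $3n$ vertices. -/

import Mathlib

namespace Hypergraph

/-- `H` is a (finite) `k`-partite `k`-graph with partition classes `P 0, …, P (k - 1)`: the classes
partition the vertex set, and every edge meets every class in exactly one vertex. -/
structure IsKPartite {α : Type*} {k : ℕ} (H : Hypergraph α) (P : Fin k → Set α) : Prop where
  finite_vertexSet : H.vertexSet.Finite
  disjoint : ∀ i j, i ≠ j → Disjoint (P i) (P j)
  iUnion_eq : ⋃ i, P i = H.vertexSet
  ncard_inter : ∀ e ∈ H.edgeSet, ∀ i, (e ∩ P i).ncard = 1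

/-- The degree of a vertex: the number of edges containing it. -/
noncomputable def vertexDegree {α : Type*} (H : Hypergraph α) (v : α) : ℕ :=
  {e ∈ H.edgeSet | v ∈ e}.ncard

/-- The minimum vertex degree `δ₁(H)`. -/
noncomputable def minVertexDegree {α : Type*} (H : Hypergraph α) : ℕ :=
  sInf (H.vertexDegree '' H.vertexSet)

/-- A matching: a set of pairwise disjoint edges. -/
def IsMatching {α : Type*} (H : Hypergraph α) (M : Set (Set α)) : Prop :=
  M ⊆ H.edgeSet ∧ ∀ e ∈ M, ∀ f ∈ M, e ≠ f → Disjoint e f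

/-- `H` has a matching that covers all its vertices. -/
def HasPerfectMatching {α : Type*} (H : Hypergraph α) : Prop :=
  ∃ M, H.IsMatching M ∧ ⋃₀ M = H.vertexSet

/-- Given classes `P i` and subsets `W i ⊆ P i`, put `W = ⋃ i, W i`. This is the hypergraph of all
transversals of the classes that meet `W` but are not contained in `W`. For three classes with
`|P i| = n` and `|W i| = d i` it is `H'(n; d₁, d₂, d₃)`: with `U` the complement of `W`, its edges
are those of types `UUW` and `UWW`. -/
def mixedTransversals {α : Type*} {k : ℕ} (P W : Fin k → Set α) : Hypergraph α where
  vertexSet := ⋃ i, P i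
  edgeSet := {e | e ⊆ ⋃ i, P i ∧ (∀ i, (e ∩ P i).ncard = 1) ∧
    (e ∩ ⋃ i, W i).Nonempty ∧ ¬ e ⊆ ⋃ i, W i}
  subset_vertexSet_of_mem_edgeSet' := fun _ he => he.1

/-- `H`, with partition classes `P 0, P 1, P 2` of size `n`, is `ε`-close to
`H'(n; d 0, d 1, d 2)`: for some choice of `W i ⊆ P i` with `|W i| = d i`, at most `ε n ^ 3` edges
of `H'(n; d 0, d 1, d 2)` are missing from `H`. -/
def IsClose {α : Type*} (H : Hypergraph α) (P : Fin 3 → Set α) (n : ℕ) (d : Fin 3 → ℕ)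
    (ε : ℝ) : Prop :=
  ∃ W : Fin 3 → Set α, (∀ i, W i ⊆ P i ∧ (W i).ncard = d i) ∧
    (((mixedTransversals P W).edgeSet \ H.edgeSet).ncard : ℝ) ≤ ε * (n : ℝ) ^ 3

/-- The part sizes `⌊m / 3⌋, ⌊(m + 1) / 3⌋, ⌊(m + 2) / 3⌋`, so that `H'₃(n; m)` is
`H'(n; d 0, d 1, d 2)` with `d = equitableSizes m`. -/
def equitableSizes (m : ℕ) (i : Fin 3) : ℕ := (m + i) / 3

/-- The minimum degree threshold. -/
noncomputable def degreeThreshold (n : ℕ) : ℝ :=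
  if n % 3 = 0 then (5 * (n : ℝ) ^ 2 - 6 * n) / 9
  else if n % 3 = 1 then (5 * (n : ℝ) ^ 2 - 4 * n - 1) / 9
  else (5 * (n : ℝ) ^ 2 - 8 * n + 5) / 9

end Hypergraph

/-! Call a vertex bad if it lies in many mixed triples that are not edges; closeness leaves only a
tiny proportion of bad vertices. If all remaining vertices are good, `r` are left in each class and
exactly `r` of them lie in `W`, the rest splits into three balanced boxes. In each box one class
lies in `W` and the other two avoid it, so nearly all its triples are edges and an augmentation
argument gives a perfect matching (`exists_matching_of_dense_box`,
`exists_perfect_matching_of_balanced`). A small surplus of `W` is removed beforehand by edges with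
two vertices in `W` (`exists_perfect_matching_of_good`).

The danger is a deficit of `W`, created by discarding its `s` bad vertices. The exact degree
threshold is used here: the complement of the good part of `W` has `2 n + s` vertices, and
`exists_matching_in_box` finds `s` disjoint edges inside it. The remaining bad vertices are covered
greedily by edges with at most one vertex in the good part of `W`, so the deficit does not reopen.

For the `s` disjoint edges, vertices of high degree in the box are set aside by induction. If none
exists, a maximum matching that is too small meets too few edges, while the threshold forces many.
One tight case, two edges in a perfectly balanced box with `n ≡ 2 (mod 3)`, is settled by the
structure of intersecting families (`false_of_intersecting`). -/

namespace TripartiteMatching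

open Finset

/-! ### Matchings of transversals, swaps and dense boxes -/

section

variable {V : Type*}

/-- Two transversals of three copies of `V` are disjoint if they differ in every coordinate. -/
def Disj (e f : Fin 3 → V) : Prop := ∀ i, e i ≠ f i

/-- `M` is a set of pairwise disjoint members of `E`. -/
def IsMatchingOf (E M : Finset (Fin 3 → V)) : Prop :=
  M ⊆ E ∧ ∀ e ∈ M, ∀ f ∈ M, e ≠ f → Disj e f

theorem Disj.symm {e f : Fin 3 → V} (h : Disj e f) : Disj f e := fun i => (h i).symm

theorem Disj.ne {e f : Fin 3 → V} (h : Disj e f) : e ≠ f := fun hef => h 0 (by rw [hef])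

theorem isMatchingOf_empty (E : Finset (Fin 3 → V)) : IsMatchingOf E ∅ := by
  simp [IsMatchingOf]

theorem IsMatchingOf.mono {E F M : Finset (Fin 3 → V)} (h : IsMatchingOf E M) (hEF : E ⊆ F) :
    IsMatchingOf F M := ⟨h.1.trans hEF, h.2⟩

theorem IsMatchingOf.subset {E M N : Finset (Fin 3 → V)} (h : IsMatchingOf E M) (hN : N ⊆ M) :
    IsMatchingOf E N := ⟨hN.trans h.1, fun e he f hf => h.2 e (hN he) f (hN hf)⟩

theorem isMatchingOf_singleton {E : Finset (Fin 3 → V)} {e : Fin 3 → V} (he : e ∈ E) :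
    IsMatchingOf E {e} := by
  refine ⟨by simpa using he, ?_⟩
  intro a ha b hb hab
  simp only [mem_singleton] at ha hb
  exact absurd (ha.trans hb.symm) hab

theorem fin_three_cases {i j : Fin 3} : j = i ∨ j = i + 1 ∨ j = i + 2 := by
  revert i j; decide

theorem forall_fin_three (i : Fin 3) {p : Fin 3 → Prop} (h0 : p i) (h1 : p (i + 1))
    (h2 : p (i + 2)) : ∀ j, p j := fun j => by
  rcases fin_three_cases (i := i) (j := j) with rfl | rfl | rfl <;> assumption

theorem sum_fin_three {β : Type*} [AddCommMonoid β] (i : Fin 3) (f : Fin 3 → β) :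
    ∑ j, f j = f i + f (i + 1) + f (i + 2) := by
  rw [Fin.sum_univ_three]
  fin_cases i
  · rfl
  · change f 0 + f 1 + f 2 = f 1 + f 2 + f 0
    abel
  · change f 0 + f 1 + f 2 = f 2 + f 0 + f 1
    abel

theorem add_one_ne_self (i : Fin 3) : i + 1 ≠ i := by revert i; decide

theorem add_two_ne_self (i : Fin 3) : i + 2 ≠ i := by revert i; decide

theorem add_one_ne_add_two (i : Fin 3) : i + 1 ≠ i + 2 := by revert i; decide

theorem erase_fin_three (i : Fin 3) : (univ.erase i : Finset (Fin 3)) = {i + 1, i + 2} := by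
  revert i; decide

/-- The edge through `x i` that takes its other two vertices from `e` and `f`. -/
def swapEdge (x e f : Fin 3 → V) (i : Fin 3) : Fin 3 → V :=
  fun j => if j = i then x i else if j = i + 1 then e j else f j

theorem swapEdge_self (x e f : Fin 3 → V) (i : Fin 3) : swapEdge x e f i i = x i := by
  simp [swapEdge]

theorem swapEdge_one (x e f : Fin 3 → V) (i : Fin 3) :
    swapEdge x e f i (i + 1) = e (i + 1) := by
  simp [swapEdge]

theorem swapEdge_two (x e f : Fin 3 → V) (i : Fin 3) :
    swapEdge x e f i (i + 2) = f (i + 2) := by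
  simp [swapEdge, (add_one_ne_add_two i).symm]

theorem swapEdge_mem (x e f : Fin 3 → V) (i j : Fin 3) :
    swapEdge x e f i j = x j ∨ swapEdge x e f i j = e j ∨ swapEdge x e f i j = f j := by
  rcases fin_three_cases (i := i) (j := j) with rfl | rfl | rfl
  · exact Or.inl (swapEdge_self ..)
  · exact Or.inr (Or.inl (swapEdge_one ..))
  · exact Or.inr (Or.inr (swapEdge_two ..))

/-- The roles of `x`, `e`, `f` rotate cyclically with `i`, so in each class the three swap edges use
three different sources. -/
theorem swapEdge_disj {x e f : Fin 3 → V} (hxe : Disj x e) (hxf : Disj x f) (hef : Disj e f)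
    {i j : Fin 3} (hij : i ≠ j) : Disj (swapEdge x e f i) (swapEdge x e f j) := by
  intro k
  have h1 := hxe k
  have h2 := hxf k
  have h3 := hef k
  have h1' := h1.symm
  have h2' := h2.symm
  have h3' := h3.symm
  fin_cases i <;> fin_cases j <;> first | exact absurd rfl hij | skip
  all_goals fin_cases k <;> simp_all [swapEdge]

theorem exists_maximum_matching (E : Finset (Fin 3 → V)) :
    ∃ M, IsMatchingOf E M ∧ ∀ N, IsMatchingOf E N → #N ≤ #M := by
  classical
  obtain ⟨M, hM, h⟩ := exists_max_image (E.powerset.filter fun M => IsMatchingOf E M) card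
    ⟨∅, by simp [isMatchingOf_empty]⟩
  refine ⟨M, (mem_filter.1 hM).2, fun N hN => h N ?_⟩
  simp [hN, hN.1]

variable [DecidableEq V]

theorem IsMatchingOf.union {E M N : Finset (Fin 3 → V)} (hM : IsMatchingOf E M)
    (hN : IsMatchingOf E N) (h : ∀ e ∈ M, ∀ f ∈ N, Disj e f) :
    IsMatchingOf E (M ∪ N) ∧ #(M ∪ N) = #M + #N := by
  refine ⟨⟨union_subset hM.1 hN.1, ?_⟩, card_union_of_disjoint ?_⟩
  · intro e he f hf hef
    rcases mem_union.1 he with he | he <;> rcases mem_union.1 hf with hf | hf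
    · exact hM.2 e he f hf hef
    · exact h e he f hf
    · exact (h f hf e he).symm
    · exact hN.2 e he f hf hef
  · rw [Finset.disjoint_left]
    exact fun e he hf => (h e he e hf).ne rfl

theorem IsMatchingOf.insert {E M : Finset (Fin 3 → V)} {e : Fin 3 → V} (hM : IsMatchingOf E M)
    (he : e ∈ E) (h : ∀ f ∈ M, Disj e f) :
    IsMatchingOf E (insert e M) ∧ #(insert e M) = #M + 1 := by
  have := (isMatchingOf_singleton he).union hM (by simpa using h)
  rw [← Finset.insert_eq] at this
  exact ⟨this.1, by rw [this.2, card_singleton, add_comm]⟩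

/-- The vertices of `M` in class `i` are as many as the edges. -/
theorem IsMatchingOf.card_image {E M : Finset (Fin 3 → V)} (hM : IsMatchingOf E M) (i : Fin 3) :
    #(M.image fun e => e i) = #M :=
  card_image_of_injOn fun e he f hf hef => by
    by_contra hne
    exact hM.2 e he f hf hne i hef

theorem card_slice (A : Fin 3 → Finset V) {i : Fin 3} {v : V} (hv : v ∈ A i) :
    #{e ∈ Fintype.piFinset A | e i = v} = #(A (i + 1)) * #(A (i + 2)) := by
  rw [Fintype.card_filter_piFinset_eq_of_mem _ _ hv]
  rw [erase_fin_three, prod_pair (add_one_ne_add_two i)]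

section Fintype

variable [Fintype V]

theorem card_two_fixed_le (i j : Fin 3) (hij : i ≠ j) (v w : V) :
    #{e : Fin 3 → V | e i = v ∧ e j = w} ≤ Fintype.card V := by
  obtain ⟨k, hk⟩ : ∃ k : Fin 3, ∀ l, l = i ∨ l = j ∨ l = k := by revert i j; decide
  refine (card_le_card_of_injOn (fun e => e k) (fun e _ => mem_univ _) ?_).trans_eq card_univ
  intro e he f hf hef
  simp only [coe_filter, mem_univ, true_and, Set.mem_ofPred_eq] at he hf
  funext l
  rcases hk l with rfl | rfl | rfl
  · rw [he.1, hf.1]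
  · rw [he.2, hf.2]
  · exact hef

/-- The greedy step: an edge of `M` avoiding `v` can block a triple through `v` only in the other
two classes, hence at most `2 * Fintype.card V` of them. -/
theorem exists_disj_of_card_lt {M F : Finset (Fin 3 → V)} {i : Fin 3} {v : V}
    (hF : ∀ e ∈ F, e i = v) (hM : ∀ f ∈ M, f i ≠ v)
    (hlt : 2 * #M * Fintype.card V < #F) : ∃ e ∈ F, ∀ f ∈ M, Disj e f := by
  by_contra! hcon
  refine hlt.not_ge ?_
  have hsub : F ⊆ M.biUnion fun f =>
      ({e : Fin 3 → V | e i = v ∧ e (i + 1) = f (i + 1)} : Finset _) ∪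
      ({e : Fin 3 → V | e i = v ∧ e (i + 2) = f (i + 2)} : Finset _) := by
    intro e he
    obtain ⟨f, hf, hef⟩ := hcon e he
    simp only [Disj, not_forall, not_not] at hef
    obtain ⟨j, hj⟩ := hef
    simp only [mem_biUnion, mem_union, mem_filter, mem_univ, true_and, hF e he]
    refine ⟨f, hf, ?_⟩
    rcases fin_three_cases (i := i) (j := j) with rfl | rfl | rfl
    · exact absurd (hj.symm.trans (hF e he)) (hM f hf)
    · exact Or.inl hj
    · exact Or.inr hj
  refine (card_le_card hsub).trans (card_biUnion_le.trans ?_)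
  calc _ ≤ ∑ _f ∈ M, 2 * Fintype.card V := sum_le_sum fun f _ => by
        refine (card_union_le _ _).trans ?_
        rw [two_mul]
        exact add_le_add (card_two_fixed_le _ _ (add_one_ne_self i).symm _ _)
          (card_two_fixed_le _ _ (add_two_ne_self i).symm _ _)
    _ = _ := by rw [sum_const, smul_eq_mul]; ring

end Fintype

/-- Replacing two edges of a matching by the three swap edges through an uncovered triple. -/
theorem IsMatchingOf.augment {E M : Finset (Fin 3 → V)} (hM : IsMatchingOf E M)
    {x e f : Fin 3 → V} (he : e ∈ M) (hf : f ∈ M) (hef : e ≠ f) (hx : ∀ g ∈ M, Disj x g)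
    (hE : ∀ i, swapEdge x e f i ∈ E) : ∃ N, IsMatchingOf E N ∧ #N = #M + 1 := by
  have hd := hM.2 e he f hf hef
  have h0 : IsMatchingOf E ((M.erase e).erase f) :=
    hM.subset ((erase_subset _ _).trans (erase_subset _ _))
  have hout : ∀ i, ∀ g ∈ (M.erase e).erase f, Disj (swapEdge x e f i) g := by
    intro i g hg j
    simp only [mem_erase] at hg
    rcases swapEdge_mem x e f i j with h | h | h <;> rw [h]
    · exact hx g hg.2.2 j
    · exact hM.2 e he g hg.2.2 hg.2.1.symm j
    · exact hM.2 f hf g hg.2.2 hg.1.symm j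
  have hs : ∀ {i j : Fin 3}, i ≠ j → Disj (swapEdge x e f i) (swapEdge x e f j) :=
    swapEdge_disj (hx e he) (hx f hf) hd
  have c0 : #((M.erase e).erase f) + 2 = #M := by
    rw [card_erase_of_mem (by simp [hef.symm, hf]), card_erase_of_mem he]
    have : 1 < #M := one_lt_card.2 ⟨e, he, f, hf, hef⟩
    omega
  obtain ⟨h1, c1⟩ := h0.insert (hE 0) (hout 0)
  obtain ⟨h2, c2⟩ := h1.insert (hE 1) (by
    intro g hg
    rcases mem_insert.1 hg with rfl | hg
    · exact hs (by decide)
    · exact hout 1 g hg)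
  obtain ⟨h3, c3⟩ := h2.insert (hE 2) (by
    intro g hg
    rcases mem_insert.1 hg with rfl | hg
    · exact hs (by decide)
    rcases mem_insert.1 hg with rfl | hg
    · exact hs (by decide)
    · exact hout 2 g hg)
  exact ⟨_, h3, by omega⟩

/-- A balanced box in which every vertex is in almost all triples has a perfect matching. -/
theorem exists_matching_of_dense_box (E : Finset (Fin 3 → V)) (A : Fin 3 → Finset V) (w : ℕ)
    (hw : 3 ≤ w) (hA : ∀ i, #(A i) = w)
    (hmiss : ∀ i, ∀ v ∈ A i, 16 * #{e ∈ Fintype.piFinset A | e i = v ∧ e ∉ E} ≤ w ^ 2) :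
    ∃ M, IsMatchingOf (E ∩ Fintype.piFinset A) M ∧ #M = w := by
  obtain ⟨M, hM, hmax⟩ := exists_maximum_matching (E ∩ Fintype.piFinset A)
  have hMA : ∀ e ∈ M, ∀ i, e i ∈ A i := fun e he =>
    Fintype.mem_piFinset.1 (mem_inter.1 (hM.1 he)).2
  have himg : ∀ i, M.image (fun e => e i) ⊆ A i := fun i => image_subset_iff.2 fun e he => hMA e he i
  have hle : #M ≤ w := by
    rw [← hM.card_image 0, ← hA 0]
    exact card_le_card (himg 0)
  refine ⟨M, hM, hle.antisymm ?_⟩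
  by_contra! hlt
  set R : Fin 3 → Finset V := fun i => A i \ M.image fun e => e i with hR
  have hRc : ∀ i, #(R i) = w - #M := fun i => by
    rw [hR, card_sdiff_of_subset (himg i), hA, hM.card_image]
  have hRA : ∀ i, ∀ v ∈ R i, v ∈ A i := fun i v hv => (mem_sdiff.1 hv).1
  have hRM : ∀ x ∈ Fintype.piFinset R, ∀ g ∈ M, Disj x g := by
    intro x hx g hg i hi
    have := (mem_sdiff.1 (Fintype.mem_piFinset.1 hx i)).2
    exact this (mem_image.2 ⟨g, hg, hi.symm⟩)
  have hne : ∀ i, (R i).Nonempty := fun i => card_pos.1 (by rw [hRc]; omega)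
  choose x hx using hne
  have hxR : x ∈ Fintype.piFinset R := Fintype.mem_piFinset.2 hx
  -- By maximality no uncovered triple is an edge, so an uncovered vertex already misses `(w - #M) ^
  -- 2` triples. This forces `#M` to be at least `3 w / 4`.
  have hr : 16 * (w - #M) ^ 2 ≤ w ^ 2 := by
    refine le_trans ?_ (hmiss 0 (x 0) (hRA 0 _ (hx 0)))
    have : #{e ∈ Fintype.piFinset R | e 0 = x 0} = (w - #M) ^ 2 := by
      rw [card_slice R (hx 0), hRc, hRc, sq]
    rw [← this]
    refine Nat.mul_le_mul_left _ (card_le_card ?_)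
    intro e he
    simp only [mem_filter] at he ⊢
    refine ⟨Fintype.mem_piFinset.2 fun i => hRA i _ (Fintype.mem_piFinset.1 he.1 i), he.2, ?_⟩
    intro heE
    have := hM.insert (e := e) (mem_inter.2 ⟨heE, Fintype.mem_piFinset.2 fun i =>
      hRA i _ (Fintype.mem_piFinset.1 he.1 i)⟩) (hRM e he.1)
    have h2 := hmax _ this.1
    omega
  have hsw : ∀ e ∈ M, ∀ f ∈ M, ∀ i, swapEdge x e f i ∈ Fintype.piFinset A := by
    intro e he f hf i
    refine Fintype.mem_piFinset.2 fun j => ?_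
    rcases swapEdge_mem x e f i j with h | h | h <;> rw [h]
    · exact hRA j _ (hx j)
    · exact hMA e he j
    · exact hMA f hf j
  have hpair : ∀ p ∈ M.offDiag, ∃ i, swapEdge x p.1 p.2 i ∉ E := by
    intro p hp
    by_contra! hcon
    rw [mem_offDiag] at hp
    obtain ⟨N, hN, hc⟩ := hM.augment hp.1 hp.2.1 hp.2.2 (hRM x hxR)
      (fun i => mem_inter.2 ⟨hcon i, hsw _ hp.1 _ hp.2.1 i⟩)
    have := hmax N hN
    omega
  -- For fixed `x i`, a swap edge determines the ordered pair it came from, so failed swaps inject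
  -- into the non-edges at `x i`.
  have hcount : ∀ i, 16 * #{p ∈ M.offDiag | swapEdge x p.1 p.2 i ∉ E} ≤ w ^ 2 := by
    intro i
    refine le_trans (Nat.mul_le_mul_left _ ?_) (hmiss i (x i) (hRA i _ (hx i)))
    refine card_le_card_of_injOn (fun p => swapEdge x p.1 p.2 i) ?_ ?_
    · intro p hp
      simp only [coe_filter, mem_offDiag, Set.mem_ofPred_eq] at hp ⊢
      exact ⟨hsw _ hp.1.1 _ hp.1.2.1 i, swapEdge_self .., hp.2⟩
    · intro p hp q hq hpq
      simp only [coe_filter, mem_offDiag, Set.mem_ofPred_eq] at hp hq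
      have h1 := congrFun hpq (i + 1)
      have h2 := congrFun hpq (i + 2)
      simp only [swapEdge_one, swapEdge_two] at h1 h2
      refine Prod.ext ?_ ?_
      · by_contra hn
        exact hM.2 _ hp.1.1 _ hq.1.1 hn _ h1
      · by_contra hn
        exact hM.2 _ hp.1.2.1 _ hq.1.2.1 hn _ h2
  have htot : #M.offDiag ≤ ∑ i, #{p ∈ M.offDiag | swapEdge x p.1 p.2 i ∉ E} := by
    refine le_trans (card_le_card ?_) card_biUnion_le
    intro p hp
    obtain ⟨i, hi⟩ := hpair p hp
    exact mem_biUnion.2 ⟨i, mem_univ _, mem_filter.2 ⟨hp, hi⟩⟩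
  rw [Fin.sum_univ_three, offDiag_card] at htot
  have h0 := hcount 0
  have h1 := hcount 1
  have h2 := hcount 2
  have h4 : 4 * (w - #M) ≤ w := by
    by_contra! hc
    nlinarith
  have h5 : 3 * w ≤ 4 * #M := by omega
  -- With `#M ≥ 3 w / 4` this would give `w ≤ 2`.
  have h6 : 16 * (#M * #M) ≤ 3 * w ^ 2 + 16 * #M := by omega
  nlinarith

end

/-! ### Arithmetic of the degree threshold -/

section

/-- In terms of `m = n / 3` the threshold is an integer in every residue class, so the strict
inequality gains a full unit. -/
theorem lt_of_degreeThreshold_lt {n D : ℕ} (h : Hypergraph.degreeThreshold n < D) :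
    ∃ m, (n = 3 * m ∧ 5 * m ^ 2 + 1 ≤ D + 2 * m) ∨
      (n = 3 * m + 1 ∧ 5 * m ^ 2 + 2 * m + 1 ≤ D) ∨
      (n = 3 * m + 2 ∧ 5 * m ^ 2 + 4 * m + 2 ≤ D) := by
  refine ⟨n / 3, ?_⟩
  have hn := Nat.div_add_mod n 3
  generalize n / 3 = m at hn ⊢
  unfold Hypergraph.degreeThreshold at h
  have h3 : n % 3 = 0 ∨ n % 3 = 1 ∨ n % 3 = 2 := by omega
  rcases h3 with h3 | h3 | h3 <;> rw [h3] at hn <;> simp only [h3] at h <;> norm_num at h <;>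
    subst hn <;> push_cast at h
  · refine Or.inl ⟨rfl, ?_⟩
    have : ((5 * m ^ 2 : ℕ) : ℝ) < ((D + 2 * m : ℕ) : ℝ) := by push_cast; linarith
    exact_mod_cast this
  · refine Or.inr (Or.inl ⟨rfl, ?_⟩)
    have : ((5 * m ^ 2 + 2 * m : ℕ) : ℝ) < ((D : ℕ) : ℝ) := by push_cast; linarith
    exact_mod_cast this
  · refine Or.inr (Or.inr ⟨rfl, ?_⟩)
    have : ((5 * m ^ 2 + 4 * m + 1 : ℕ) : ℝ) < ((D : ℕ) : ℝ) := by push_cast; linarith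
    exact_mod_cast this

/-- Let `x ≤ y`. If `x < S / 3`, then `y ≥ S - 2 x`, and the concave function `x (S - 2 x)` equals
`S ^ 2 / 9` at both ends of `[S / 6, S / 3]`. -/
theorem sq_sum_le_nine_mul {S x y z : ℕ} (h : x + y + z = S) (hx : z ≤ x) (hy : z ≤ y)
    (hx6 : S ≤ 6 * x) (hy6 : S ≤ 6 * y) : S ^ 2 ≤ 9 * (x * y) := by
  wlog hxy : x ≤ y generalizing x y
  · rw [mul_comm x y]
    exact this (by omega) hy hx hy6 hx6 (by omega)
  zify at *
  rcases le_total (S : ℤ) (3 * x) with h3 | h3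
  · nlinarith
  · have : (S : ℤ) - 2 * x ≤ y := by linarith
    nlinarith [mul_nonneg (sub_nonneg.2 hx6) (sub_nonneg.2 h3),
      mul_le_mul_of_nonneg_left this (Int.natCast_nonneg x)]

/-- If the sum is `3 a - 1` or `3 a - 2`, the product of the two largest parts is at least
`a ^ 2 - 1` or `a ^ 2 - a`, respectively. -/
theorem mul_le_mul_of_sum_eq {a x y z : ℕ} (hx : z ≤ x) (hy : z ≤ y)
    (hx2 : 3 * a ≤ 4 * x) (hy2 : 3 * a ≤ 4 * y) (ha : 8 ≤ a) :
    (x + y + z + 1 = 3 * a → a * a ≤ x * y + 1) ∧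
    (x + y + z + 2 = 3 * a → a * a ≤ x * y + a) := by
  wlog hxy : x ≤ y generalizing x y
  · rw [mul_comm x y, add_comm x y]
    exact this hy hx hy2 hx2 (by omega)
  constructor
  · intro h
    rcases le_or_gt a x with h1 | h1
    · exact (Nat.mul_le_mul h1 (h1.trans hxy)).trans (Nat.le_add_right _ _)
    · obtain ⟨d, rfl⟩ := Nat.exists_eq_add_of_lt h1
      have : x + 3 * d + 2 ≤ y := by omega
      have hd : 3 * (d + 1) ≤ x := by omega
      nlinarith [Nat.mul_le_mul_left x this]
  · intro h
    rcases le_or_gt a x with h1 | h1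
    · exact (Nat.mul_le_mul h1 (h1.trans hxy)).trans (Nat.le_add_right _ _)
    · obtain ⟨d, rfl⟩ := Nat.exists_eq_add_of_lt h1
      have : x + 3 * d + 1 ≤ y := by omega
      have hd : 3 * (d + 1) ≤ x := by omega
      nlinarith [Nat.mul_le_mul_left x this]

/-- Leaving the perfectly balanced case gains a term linear in `a`, which isolates the single tight
case of `box_degree_large`. -/
theorem mul_gap_of_ne {a x y z : ℕ} (h : x + y + z = 3 * a) (hx : z ≤ x) (hy : z ≤ y)
    (hx2 : 3 * a ≤ 4 * x) (hy2 : 3 * a ≤ 4 * y) (ha : 8 ≤ a) (hne : z ≠ a) :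
    a * a + a ≤ x * y + 2 := by
  wlog hxy : x ≤ y generalizing x y
  · rw [mul_comm x y]
    exact this (by omega) hy hx hy2 hx2 (by omega)
  rcases lt_trichotomy a x with h1 | rfl | h1
  · nlinarith [Nat.mul_le_mul h1 (h1.trans_le hxy)]
  · have : a + 1 ≤ y := by omega
    nlinarith
  · obtain ⟨d, rfl⟩ := Nat.exists_eq_add_of_lt h1
    have : x + 3 * (1 + d) ≤ y := by omega
    have hd : 3 * (d + 1) ≤ x := by omega
    nlinarith [Nat.mul_le_mul_left x this]

theorem box_degree_pos {n D s x y z : ℕ} (hD : Hypergraph.degreeThreshold n < D) (hn : 1000 ≤ n)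
    (hs : 1 ≤ s) (hsum : x + y + z = 2 * n + s) (hx : z ≤ x) (hy : z ≤ y)
    (hx2 : n + 2 * s ≤ 2 * x) (hy2 : n + 2 * s ≤ 2 * y) : n ^ 2 + 1 ≤ x * y + D := by
  obtain ⟨m, ⟨rfl, h⟩ | ⟨rfl, h⟩ | ⟨rfl, h⟩⟩ := lt_of_degreeThreshold_lt hD
  all_goals rcases hs.eq_or_lt with rfl | hs'
  · have := (mul_le_mul_of_sum_eq (a := 2 * m + 1) hx hy (by omega) (by omega) (by omega)).2
      (by omega)
    linarith
  · have := sq_sum_le_nine_mul hsum hx hy (by omega) (by omega)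
    have hms := Nat.mul_le_mul_left m hs'
    have h0 := Nat.zero_le (s * s)
    linarith
  · have := sq_sum_le_nine_mul hsum hx hy (by omega) (by omega)
    linarith
  · have := sq_sum_le_nine_mul hsum hx hy (by omega) (by omega)
    have hms := Nat.mul_le_mul_left m hs'
    have h0 := Nat.zero_le (s * s)
    linarith
  · have := (mul_le_mul_of_sum_eq (a := 2 * m + 2) hx hy (by omega) (by omega) (by omega)).1
      (by omega)
    linarith
  · have := sq_sum_le_nine_mul hsum hx hy (by omega) (by omega)
    have hms := Nat.mul_le_mul_left m hs'
    have h0 := Nat.zero_le (s * s)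
    linarith

/-- Vertices of the smallest class get box degree at least `n s / 5`. The factor `1 / 5` is just
below the margin `2 n / 9` that `n = 3 m`, `s = 1` leaves to leading order. The exception has `n = 3
m + 2` and all classes of size `2 m + 2`, where only degree two is guaranteed. -/
theorem box_degree_large {n D s x y z : ℕ} (hD : Hypergraph.degreeThreshold n < D)
    (hn : 1000 ≤ n) (hs : 1 ≤ s) (hsum : x + y + z = 2 * n + (s + 1)) (hx : z ≤ x) (hy : z ≤ y)
    (hx2 : n + 2 * (s + 1) ≤ 2 * x) (hy2 : n + 2 * (s + 1) ≤ 2 * y) :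
    5 * n ^ 2 + n * s ≤ 5 * (x * y + D) ∨
      s = 1 ∧ x = z ∧ y = z ∧ n ^ 2 + 2 ≤ z * z + D := by
  obtain ⟨m, ⟨rfl, h⟩ | ⟨rfl, h⟩ | ⟨rfl, h⟩⟩ := lt_of_degreeThreshold_lt hD
  · have := sq_sum_le_nine_mul hsum hx hy (by omega) (by omega)
    have hms := Nat.mul_le_mul_left m hs
    have h0 := Nat.zero_le (s * s)
    left
    linarith
  · have := sq_sum_le_nine_mul hsum hx hy (by omega) (by omega)
    have hms := Nat.mul_le_mul_left m hs
    have h0 := Nat.zero_le (s * s)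
    left
    linarith
  · rcases hs.eq_or_lt with rfl | hs'
    · by_cases hz : z = 2 * m + 2
      · subst hz
        have hx' : x = 2 * m + 2 := by omega
        have hy' : y = 2 * m + 2 := by omega
        refine Or.inr ⟨rfl, hx', hy', ?_⟩
        linarith
      · left
        have := mul_gap_of_ne (a := 2 * m + 2) (by omega) hx hy (by omega) (by omega) (by omega) hz
        linarith
    · have := sq_sum_le_nine_mul hsum hx hy (by omega) (by omega)
      have hms := Nat.mul_le_mul_left m hs'
      have h0 := Nat.zero_le (s * s)
      left
      linarith

end

/-! ### Intersecting tripartite families -/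

section

/-- No relation describing an intersecting family has all vertex degrees at least two, if every
class has three vertices. -/
theorem false_of_intersecting_of_pair {V : Type*} {F : V → V → V → Prop} {X Y : V → Prop}
    (hF : ∀ a b c a' b' c', F a b c → F a' b' c' → a = a' ∨ b = b' ∨ c = c')
    (hX : ∀ a, ∃ a', X a' ∧ a' ≠ a) (hY : ∀ b, ∃ b', Y b' ∧ b' ≠ b)
    (hdX : ∀ a, X a → ∃ b c b' c', F a b c ∧ F a b' c' ∧ (b ≠ b' ∨ c ≠ c'))
    (hdY : ∀ b, Y b → ∃ a c a' c', F a b c ∧ F a' b c' ∧ (a ≠ a' ∨ c ≠ c'))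
    {x y z z' : V} (h1 : F x y z) (h2 : F x y z') (hz : z ≠ z') : False := by
  obtain ⟨x', hx', hxx⟩ := hX x
  obtain ⟨y', hy', hyy⟩ := hY y
  obtain ⟨b, c, b', c', e1, e2, hne⟩ := hdX x' hx'
  obtain ⟨p, q, p', q', f1, f2, hne'⟩ := hdY y' hy'
  -- An edge avoiding both `x` and `y` would need both `z` and `z'`. So edges at `x'` pass through
  -- `y` and edges at `y'` through `x`; they can meet only in the third class, where two distinct
  -- edges at `x'` have distinct vertices.
  have hb : ∀ b c, F x' b c → b = y := by
    intro b c h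
    have := hF _ _ _ _ _ _ h h1
    have := hF _ _ _ _ _ _ h h2
    grind
  have hp : ∀ p q, F p y' q → p = x := by
    intro p q h
    have := hF _ _ _ _ _ _ h h1
    have := hF _ _ _ _ _ _ h h2
    grind
  have := hb _ _ e1
  have := hb _ _ e2
  have := hp _ _ f1
  have := hp _ _ f2
  have := hF _ _ _ _ _ _ e1 f1
  have := hF _ _ _ _ _ _ e1 f2
  have := hF _ _ _ _ _ _ e2 f1
  have := hF _ _ _ _ _ _ e2 f2
  grind

/-- If two edges share only their first vertex `x`, any edge off `x` must cross between them, in one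
of two ways. Two further vertices `u`, `v` of degree two each realize both ways, giving disjoint
edges. Otherwise two edges share a pair, and `false_of_intersecting_of_pair` applies. -/
theorem false_of_intersecting {V : Type*} [Nonempty V] {F : V → V → V → Prop} {X Y Z : V → Prop}
    (hF : ∀ a b c a' b' c', F a b c → F a' b' c' → a = a' ∨ b = b' ∨ c = c')
    (hX : ∀ a a₂, ∃ a', X a' ∧ a' ≠ a ∧ a' ≠ a₂) (hY : ∀ b b₂, ∃ b', Y b' ∧ b' ≠ b ∧ b' ≠ b₂)
    (hZ : ∀ c c₂, ∃ c', Z c' ∧ c' ≠ c ∧ c' ≠ c₂)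
    (hdX : ∀ a, X a → ∃ b c b' c', F a b c ∧ F a b' c' ∧ (b ≠ b' ∨ c ≠ c'))
    (hdY : ∀ b, Y b → ∃ a c a' c', F a b c ∧ F a' b c' ∧ (a ≠ a' ∨ c ≠ c'))
    (hdZ : ∀ c, Z c → ∃ a b a' b', F a b c ∧ F a' b' c ∧ (a ≠ a' ∨ b ≠ b')) : False := by
  have nX : ∀ a b c b' c', F a b c → F a b' c' → b = b' ∨ c = c' := by
    intro x y z y' z' h1 h2
    by_contra! hne
    obtain ⟨u, hu, hux, -⟩ := hX x x
    obtain ⟨v, hv, hvx, hvu⟩ := hX x u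
    have hall : ∀ u, u ≠ x → ∀ b c, F u b c → b = y ∧ c = z' ∨ b = y' ∧ c = z := by
      intro u hu b c h
      have := hF _ _ _ _ _ _ h h1
      have := hF _ _ _ _ _ _ h h2
      grind
    obtain ⟨b, c, b', c', e1, e2, hb⟩ := hdX u hu
    obtain ⟨p, q, p', q', f1, f2, hp⟩ := hdX v hv
    have := hall u hux _ _ e1
    have := hall u hux _ _ e2
    have := hall v hvx _ _ f1
    have := hall v hvx _ _ f2
    have := hF _ _ _ _ _ _ e1 f1
    have := hF _ _ _ _ _ _ e1 f2
    grind
  have hX' : ∀ a, ∃ a', X a' ∧ a' ≠ a := fun a => by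
    obtain ⟨a', h⟩ := hX a a
    exact ⟨a', h.1, h.2.1⟩
  have hY' : ∀ a, ∃ a', Y a' ∧ a' ≠ a := fun a => by
    obtain ⟨a', h⟩ := hY a a
    exact ⟨a', h.1, h.2.1⟩
  have hZ' : ∀ a, ∃ a', Z a' ∧ a' ≠ a := fun a => by
    obtain ⟨a', h⟩ := hZ a a
    exact ⟨a', h.1, h.2.1⟩
  by_cases hex : ∃ x y z z', F x y z ∧ F x y z' ∧ z ≠ z'
  · obtain ⟨x, y, z, z', h1, h2, hz⟩ := hex
    exact false_of_intersecting_of_pair hF hX' hY' hdX hdY h1 h2 hz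
  · obtain ⟨x, hx, -⟩ := hX' (Classical.arbitrary V)
    obtain ⟨b, c, b', c', e1, e2, hne⟩ := hdX x hx
    have hb : b ≠ b' := by
      rintro rfl
      exact hex ⟨x, b, c, c', e1, e2, by tauto⟩
    have hc : c = c' := (nX _ _ _ _ _ e1 e2).resolve_left hb
    subst hc
    -- Here the shared pair lies in the first and third classes, so the last two coordinates are
    -- exchanged.
    exact false_of_intersecting_of_pair (F := fun a c b => F a b c) (by grind) hX' hZ'
      (by grind) hdZ e1 e2 hb

end

/-! ### Small matchings forced by the degree threshold -/

section

variable {V : Type*} [DecidableEq V]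

/-- Inclusion–exclusion among the `n ^ 2` triples through `v`: edges on one side, triples of the box
on the other. -/
theorem degree_add_mul_le [Fintype V] {n D : ℕ} (hV : Fintype.card V = n)
    {E : Finset (Fin 3 → V)} (hdeg : ∀ i v, D ≤ #{e ∈ E | e i = v}) (U : Fin 3 → Finset V)
    {i : Fin 3} {v : V} (hv : v ∈ U i) :
    #(U (i + 1)) * #(U (i + 2)) + D ≤ n ^ 2 + #{e ∈ E ∩ Fintype.piFinset U | e i = v} := by
  have h1 : #{e ∈ Fintype.piFinset (fun _ : Fin 3 => (univ : Finset V)) | e i = v} = n ^ 2 := by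
    rw [card_slice _ (mem_univ v), card_univ, hV, sq]
  have h2 := card_slice U hv
  have h3 : {e ∈ E | e i = v} ∪ {e ∈ Fintype.piFinset U | e i = v} ⊆
      {e ∈ Fintype.piFinset (fun _ : Fin 3 => (univ : Finset V)) | e i = v} := by
    intro e he
    simp only [mem_union, mem_filter, Fintype.mem_piFinset, mem_univ, implies_true,
      true_and] at he ⊢
    tauto
  have h4 : {e ∈ E ∩ Fintype.piFinset U | e i = v} =
      {e ∈ E | e i = v} ∩ {e ∈ Fintype.piFinset U | e i = v} := by
    rw [filter_inter_distrib]
  have h5 := card_union_add_card_inter {e ∈ E | e i = v} {e ∈ Fintype.piFinset U | e i = v}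
  have h6 := card_le_card h3
  have h7 := hdeg i v
  rw [h4]
  omega

theorem sum_card_slice {G : Finset (Fin 3 → V)} {U : Fin 3 → Finset V}
    (hG : G ⊆ Fintype.piFinset U) (i : Fin 3) : ∑ v ∈ U i, #{e ∈ G | e i = v} = #G :=
  (card_eq_sum_card_fiberwise fun _ he => Fintype.mem_piFinset.1 (hG he) i).symm

/-- Every edge meets a maximum matching. -/
theorem card_le_of_maximum {G M : Finset (Fin 3 → V)} {d : ℕ} (hM : IsMatchingOf G M)
    (hmax : ∀ N, IsMatchingOf G N → #N ≤ #M) {U : Fin 3 → Finset V}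
    (hG : G ⊆ Fintype.piFinset U) (hd : ∀ i, ∀ v ∈ U i, #{e ∈ G | e i = v} ≤ d) :
    #G ≤ 3 * #M * d := by
  have hsub : G ⊆ M.biUnion fun f => univ.biUnion fun i : Fin 3 => {e ∈ G | e i = f i} := by
    intro e he
    simp only [mem_biUnion, mem_filter, mem_univ, true_and]
    by_contra! hcon
    have := hM.insert he fun f hf i => (hcon f hf i he)
    have h2 := hmax _ this.1
    omega
  refine (card_le_card hsub).trans (card_biUnion_le.trans ?_)
  calc _ ≤ ∑ _f ∈ M, 3 * d := sum_le_sum fun f hf => by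
        refine card_biUnion_le.trans ((sum_le_sum fun i _ => hd i (f i)
          (Fintype.mem_piFinset.1 (hG (hM.1 hf)) i)).trans ?_)
        simp
    _ = _ := by rw [sum_const, smul_eq_mul]; ring

theorem exists_disj_pair {E : Finset (Fin 3 → V)} {U : Fin 3 → Finset V} (hU : ∀ i, 3 ≤ #(U i))
    (hdeg : ∀ i, ∀ v ∈ U i, 2 ≤ #{e ∈ E | e i = v}) : ∃ e ∈ E, ∃ f ∈ E, Disj e f := by
  by_contra! hcon
  have hne : Nonempty V := by
    obtain ⟨v, -⟩ := card_pos.1 (zero_lt_three.trans_le (hU 0))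
    exact ⟨v⟩
  have hthree : ∀ i, ∀ a b : V, ∃ c, c ∈ U i ∧ c ≠ a ∧ c ≠ b := by
    intro i a b
    have : #({a, b} : Finset V) < #(U i) := card_le_two.trans_lt (hU i)
    obtain ⟨c, hc, hcn⟩ := exists_mem_notMem_of_card_lt_card this
    refine ⟨c, hc, ?_⟩
    simpa using hcn
  have htwo : ∀ i, ∀ v ∈ U i, ∃ e ∈ E, ∃ f ∈ E, e i = v ∧ f i = v ∧ e ≠ f := by
    intro i v hv
    obtain ⟨e, he, f, hf, hef⟩ := one_lt_card.1 (hdeg i v hv)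
    simp only [mem_filter] at he hf
    exact ⟨e, he.1, f, hf.1, he.2, hf.2, hef⟩
  have heta : ∀ e : Fin 3 → V, ![e 0, e 1, e 2] = e := fun e => by
    funext i
    fin_cases i <;> rfl
  have hext : ∀ e f : Fin 3 → V, e 0 = f 0 → e 1 = f 1 → e 2 = f 2 → e = f := fun e f h0 h1 h2 => by
    rw [← heta e, ← heta f, h0, h1, h2]
  refine false_of_intersecting (F := fun a b c => ![a, b, c] ∈ E) (X := fun v => v ∈ U 0)
    (Y := fun v => v ∈ U 1) (Z := fun v => v ∈ U 2) ?_ (hthree 0) (hthree 1) (hthree 2) ?_ ?_ ?_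
  · intro a b c a' b' c' h h'
    have := hcon _ h _ h'
    simp only [Disj, not_forall, not_not] at this
    obtain ⟨i, hi⟩ := this
    fin_cases i <;> simp at hi <;> tauto
  · intro v hv
    obtain ⟨e, he, f, hf, h1, h2, hne⟩ := htwo 0 v hv
    refine ⟨e 1, e 2, f 1, f 2, ?_, ?_, ?_⟩
    · rwa [← h1, heta]
    · rwa [← h2, heta]
    · by_contra! h
      exact hne (hext _ _ (h1.trans h2.symm) h.1 h.2)
  · intro v hv
    obtain ⟨e, he, f, hf, h1, h2, hne⟩ := htwo 1 v hv
    refine ⟨e 0, e 2, f 0, f 2, ?_, ?_, ?_⟩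
    · rwa [← h1, heta]
    · rwa [← h2, heta]
    · by_contra! h
      exact hne (hext _ _ h.1 (h1.trans h2.symm) h.2)
  · intro v hv
    obtain ⟨e, he, f, hf, h1, h2, hne⟩ := htwo 2 v hv
    refine ⟨e 0, e 1, f 0, f 1, ?_, ?_, ?_⟩
    · rwa [← h1, heta]
    · rwa [← h2, heta]
    · by_contra! h
      exact hne (hext _ _ h.1 h.2 (h1.trans h2.symm))

/-- A nearly balanced box with `2 n + s` vertices contains a matching of size `s`. -/
theorem exists_matching_in_box [Fintype V] {n D : ℕ} (hV : Fintype.card V = n) (hn : 1000 ≤ n)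
    (hD : Hypergraph.degreeThreshold n < D) {E : Finset (Fin 3 → V)}
    (hdeg : ∀ i v, D ≤ #{e ∈ E | e i = v}) (s : ℕ) : ∀ U : Fin 3 → Finset V,
    ∑ i, #(U i) = 2 * n + s → (∀ i, n + 2 * s ≤ 2 * #(U i)) → 100 * s ≤ n →
    ∃ M, IsMatchingOf (E ∩ Fintype.piFinset U) M ∧ #M = s := by
  induction s with
  | zero => exact fun U _ _ _ => ⟨∅, isMatchingOf_empty _, rfl⟩
  | succ s ih =>
    intro U hsum hlow hs
    set G := E ∩ Fintype.piFinset U with hG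
    have hGU : G ⊆ Fintype.piFinset U := inter_subset_right
    by_cases hhigh : ∃ i, ∃ v ∈ U i, n ^ 2 < 40 * #{e ∈ G | e i = v}
    · obtain ⟨i, v, hv, hlarge⟩ := hhigh
      have hcard : ∀ j, #(U j) ≤ #(Function.update U i ((U i).erase v) j) + 1 := by
        intro j
        rcases eq_or_ne j i with rfl | hj
        · rw [Function.update_self, card_erase_add_one hv]
        · rw [Function.update_of_ne hj]
          omega
      obtain ⟨M, hM, hMs⟩ := ih (Function.update U i ((U i).erase v)) (by
        rw [sum_fin_three i] at hsum ⊢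
        rw [Function.update_self, Function.update_of_ne (add_one_ne_self i),
          Function.update_of_ne (add_two_ne_self i)]
        have := card_erase_add_one hv
        omega) (fun j => by
          have := hcard j
          have := hlow j
          omega) (by omega)
      have hsub : Fintype.piFinset (Function.update U i ((U i).erase v)) ⊆ Fintype.piFinset U := by
        refine Fintype.piFinset_subset _ _ fun j => ?_
        rcases eq_or_ne j i with rfl | hj
        · rw [Function.update_self]
          exact erase_subset _ _
        · rw [Function.update_of_ne hj]
      have hMG : IsMatchingOf G M := hM.mono (inter_subset_inter_left hsub)
      obtain ⟨e, he, hdis⟩ := exists_disj_of_card_lt (M := M) (F := {e ∈ G | e i = v}) (i := i)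
        (v := v) (by simp) (fun f hf => by
          have := Fintype.mem_piFinset.1 (mem_inter.1 (hM.1 hf)).2 i
          rw [Function.update_self] at this
          exact ne_of_mem_erase this) (by
          rw [hV, hMs]
          nlinarith)
      have := hMG.insert (mem_filter.1 he).1 hdis
      exact ⟨_, this.1, by rw [this.2, hMs]⟩
    · push Not at hhigh
      obtain ⟨M, hM, hmax⟩ := exists_maximum_matching G
      rcases le_or_gt (s + 1) #M with hle | hlt
      · obtain ⟨N, hN, hNc⟩ := exists_subset_card_eq hle
        exact ⟨N, hM.subset hN, hNc⟩
      exfalso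
      have hup : 40 * #G ≤ 3 * s * n ^ 2 := by
        have h1 := card_le_of_maximum hM hmax hGU (d := n ^ 2 / 40) (fun i v hv => by
          have := hhigh i v hv
          omega)
        have h2 : 40 * (n ^ 2 / 40) ≤ n ^ 2 := Nat.mul_div_le _ _
        calc 40 * #G ≤ 40 * (3 * #M * (n ^ 2 / 40)) := Nat.mul_le_mul_left _ h1
          _ = 3 * #M * (40 * (n ^ 2 / 40)) := by ring
          _ ≤ 3 * s * n ^ 2 := Nat.mul_le_mul (by omega) h2
      -- The degree bound at a vertex involves the product of the other two classes, so it is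
      -- strongest in the smallest class. Summing `n s / 5` over its at least `n / 2` vertices gives
      -- `s n ^ 2 / 10` edges, more than the `3 s n ^ 2 / 40` allowed by `hup`.
      obtain ⟨i, -, hi⟩ := exists_min_image univ (fun i => #(U i)) univ_nonempty
      have hx := hi (i + 1) (mem_univ _)
      have hy := hi (i + 2) (mem_univ _)
      have hsum' : #(U (i + 1)) + #(U (i + 2)) + #(U i) = 2 * n + (s + 1) := by
        rw [sum_fin_three i] at hsum
        omega
      have hbox : ∀ v ∈ U i, #(U (i + 1)) * #(U (i + 2)) + D ≤ n ^ 2 + #{e ∈ G | e i = v} :=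
        fun v hv => degree_add_mul_le hV hdeg U hv
      have hUi : n ≤ 2 * #(U i) := by
        have := hlow i
        omega
      rcases Nat.eq_zero_or_pos s with rfl | hspos
      · have hpos := box_degree_pos hD hn le_rfl hsum' hx hy (hlow _) (hlow _)
        obtain ⟨v, hv⟩ : (U i).Nonempty := card_pos.1 (by omega)
        have h1 := hbox v hv
        have h2 : #{e ∈ G | e i = v} ≤ #G := card_filter_le _ _
        omega
      · rcases box_degree_large hD hn hspos hsum' hx hy (hlow _) (hlow _) with h | h
        · have h1 : #(U i) * (n * s) ≤ 5 * #G := by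
            rw [← sum_card_slice hGU i, mul_sum, ← smul_eq_mul, ← sum_const]
            refine sum_le_sum fun v hv => ?_
            have := hbox v hv
            omega
          have h2 : n * (n * s) ≤ 2 * #(U i) * (n * s) := Nat.mul_le_mul_right _ hUi
          have h3 : 0 < n * (n * s) := by positivity
          nlinarith
        · obtain ⟨rfl, h1, h2, h3⟩ := h
          have hall : ∀ j, #(U j) = #(U i) := forall_fin_three i rfl h1 h2
          obtain ⟨e, he, f, hf, hef⟩ := exists_disj_pair (E := G) (U := U)
            (fun j => by rw [hall]; omega) (fun j v hv => by
              have := degree_add_mul_le hV hdeg U hv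
              rw [hall (j + 1), hall (j + 2), ← hG] at this
              omega)
          obtain ⟨h4, h5⟩ := (isMatchingOf_singleton he).insert hf
            (fun g hg => by rw [mem_singleton.1 hg]; exact hef.symm)
          have := hmax _ h4
          rw [h5, card_singleton] at this
          omega

end

/-! ### Good vertices and the balanced case -/

section

variable {V : Type*} [DecidableEq V]

/-- Edges through the vertices of `S` can be added greedily to a matching. -/
theorem IsMatchingOf.exists_cover [Fintype V] {G M₁ : Finset (Fin 3 → V)}
    (hM₁ : IsMatchingOf G M₁) (S : Finset (Fin 3 × V))
    (hS : ∀ p ∈ S, 2 * (#M₁ + #S) * Fintype.card V < #{e ∈ G | e p.1 = p.2}) :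
    ∃ M, M₁ ⊆ M ∧ IsMatchingOf G M ∧ #M ≤ #M₁ + #S ∧ ∀ p ∈ S, ∃ e ∈ M, e p.1 = p.2 := by
  induction S using Finset.induction_on with
  | empty => exact ⟨M₁, Subset.rfl, hM₁, by simp, by simp⟩
  | insert p S hp ih =>
    rw [card_insert_of_notMem hp] at hS ⊢
    obtain ⟨M, hsub, hM, hc, hcov⟩ := ih fun q hq =>
      lt_of_le_of_lt (by gcongr; omega) (hS q (mem_insert_of_mem hq))
    by_cases hpM : ∃ e ∈ M, e p.1 = p.2
    · refine ⟨M, hsub, hM, by omega, fun q hq => ?_⟩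
      rcases mem_insert.1 hq with rfl | hq
      · exact hpM
      · exact hcov q hq
    · push Not at hpM
      obtain ⟨e, he, hdis⟩ := exists_disj_of_card_lt (M := M) (F := {e ∈ G | e p.1 = p.2})
        (i := p.1) (v := p.2) (by simp) hpM
        (lt_of_le_of_lt (by gcongr; omega) (hS p (mem_insert_self _ _)))
      rw [mem_filter] at he
      obtain ⟨h1, h2⟩ := hM.insert he.1 hdis
      refine ⟨_, hsub.trans (subset_insert _ _), h1, by omega, fun q hq => ?_⟩
      rcases mem_insert.1 hq with rfl | hq
      · exact ⟨e, mem_insert_self _ _, he.2⟩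
      · obtain ⟨f, hf, hfq⟩ := hcov q hq
        exact ⟨f, mem_insert_of_mem hf, hfq⟩

variable [Fintype V]

/-- The triples outside `E` that meet `W` but are not contained in `W`. -/
def missing (W : Fin 3 → Finset V) (E : Finset (Fin 3 → V)) : Finset (Fin 3 → V) :=
  {e | ((∃ i, e i ∈ W i) ∧ ∃ i, e i ∉ W i) ∧ e ∉ E}

/-- The vertex `v` of class `i` is in few triples of `missing W E`. -/
def IsGood (W : Fin 3 → Finset V) (E : Finset (Fin 3 → V)) (i : Fin 3) (v : V) : Prop :=
  1024 * #{e ∈ missing W E | e i = v} ≤ Fintype.card V ^ 2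

instance (W : Fin 3 → Finset V) (E : Finset (Fin 3 → V)) (i : Fin 3) (v : V) :
    Decidable (IsGood W E i v) := inferInstanceAs (Decidable (_ ≤ _))

/-- One class inside `W` and one outside make every triple of the box mixed, so its non-edges are
all in `missing W E`. The constant `1024 = 16 * 8 ^ 2` turns goodness into the hypothesis of the
dense box lemma. -/
theorem exists_matching_of_good_box {W : Fin 3 → Finset V} {E : Finset (Fin 3 → V)}
    {A : Fin 3 → Finset V} {w : ℕ} (hw : 3 ≤ w) (hA : ∀ i, #(A i) = w)
    (hn : Fintype.card V ≤ 8 * w) (hgood : ∀ i, ∀ v ∈ A i, IsGood W E i v) {j k : Fin 3}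
    (hj : A j ⊆ W j) (hk : Disjoint (A k) (W k)) :
    ∃ M, IsMatchingOf (E ∩ Fintype.piFinset A) M ∧ #M = w := by
  refine exists_matching_of_dense_box E A w hw hA fun i v hv => ?_
  have h1 : #{e ∈ Fintype.piFinset A | e i = v ∧ e ∉ E} ≤ #{e ∈ missing W E | e i = v} := by
    refine card_le_card fun e he => ?_
    simp only [mem_filter, missing, Fintype.mem_piFinset, mem_univ, true_and] at he ⊢
    exact ⟨⟨⟨⟨j, hj (he.1 j)⟩, k, Finset.disjoint_left.1 hk (he.1 k)⟩, he.2.2⟩, he.2.1⟩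
  have h2 := hgood i v hv
  unfold IsGood at h2
  have h3 : Fintype.card V ^ 2 ≤ (8 * w) ^ 2 := Nat.pow_le_pow_left hn 2
  have h4 : (8 * w) ^ 2 = 64 * w ^ 2 := by ring
  omega

/-- Balance means that the part of class `i` outside `W` is exactly as large as the `W`-parts of the
other two classes together. It can thus be cut to serve both of their boxes. -/
theorem exists_perfect_matching_of_balanced {W R : Fin 3 → Finset V} {E : Finset (Fin 3 → V)}
    {r : ℕ} (hR : ∀ i, #(R i) = r) (hsum : ∑ i, #(R i ∩ W i) = r)
    (hn : 24 ≤ Fintype.card V) (hlow : ∀ i, Fintype.card V ≤ 8 * #(R i ∩ W i))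
    (hgood : ∀ i, ∀ v ∈ R i, IsGood W E i v) :
    ∃ M, IsMatchingOf (E ∩ Fintype.piFinset R) M ∧ #M = r := by
  have hY : ∀ i, #(R i \ W i) = #(R (i + 1) ∩ W (i + 1)) + #(R (i + 2) ∩ W (i + 2)) := by
    intro i
    have := card_sdiff_add_card_inter (R i) (W i)
    rw [sum_fin_three i] at hsum
    rw [hR] at this
    omega
  have hS : ∀ i, ∃ S ⊆ R i \ W i, #S = #(R (i + 1) ∩ W (i + 1)) := fun i =>
    exists_subset_card_eq (by rw [hY]; omega)
  choose S hSsub hSc using hS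
  have hTc : ∀ i, #((R i \ W i) \ S i) = #(R (i + 2) ∩ W (i + 2)) := fun i => by
    rw [card_sdiff_of_subset (hSsub i), hSc, hY]
    omega
  -- Box `i` takes its `W`-vertices from class `i`; the pieces outside `W` are assigned cyclically
  -- so that all three sides equal `#(R i ∩ W i)`.
  set A : Fin 3 → Fin 3 → Finset V := fun i j =>
    if j = i then R i ∩ W i else if j = i + 1 then (R j \ W j) \ S j else S j with hAdef
  have hA0 : ∀ i, A i i = R i ∩ W i := fun i => by simp [hAdef]
  have hA1 : ∀ i, A i (i + 1) = (R (i + 1) \ W (i + 1)) \ S (i + 1) := fun i => by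
    simp [hAdef]
  have hA2 : ∀ i, A i (i + 2) = S (i + 2) := fun i => by
    simp [hAdef, (add_one_ne_add_two i).symm]
  have hAR : ∀ i j, A i j ⊆ R j := fun i => forall_fin_three i
    (by rw [hA0]; exact inter_subset_left)
    (by rw [hA1]; exact sdiff_subset.trans sdiff_subset)
    (by rw [hA2]; exact (hSsub _).trans sdiff_subset)
  have hAc : ∀ i j, #(A i j) = #(R i ∩ W i) := fun i => forall_fin_three i
    (by rw [hA0])
    (by
      rw [hA1, hTc]
      have : i + 1 + 2 = i := by revert i; decide
      rw [this])
    (by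
      rw [hA2, hSc]
      have : i + 2 + 1 = i := by revert i; decide
      rw [this])
  have hdisj : ∀ i i', i ≠ i' → ∀ j, Disjoint (A i j) (A i' j) := by
    have h1 : ∀ j, Disjoint (R j ∩ W j) ((R j \ W j) \ S j) := fun j =>
      (disjoint_sdiff_inter (R j) (W j)).symm.mono_right sdiff_subset
    have h2 : ∀ j, Disjoint (R j ∩ W j) (S j) := fun j =>
      (disjoint_sdiff_inter (R j) (W j)).symm.mono_right (hSsub j)
    have h3 : ∀ j, Disjoint ((R j \ W j) \ S j) (S j) := fun j => sdiff_disjoint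
    intro i i' hii j
    have a0 := h1 j
    have a1 := h2 j
    have a2 := h3 j
    have e0 : ∀ i, j = i → A i j = R j ∩ W j := by
      rintro _ rfl
      exact hA0 _
    have e1 : ∀ i, j = i + 1 → A i j = (R j \ W j) \ S j := by
      rintro i rfl
      exact hA1 _
    have e2 : ∀ i, j = i + 2 → A i j = S j := by
      rintro i rfl
      exact hA2 _
    rcases fin_three_cases (i := i) (j := j) with h | h | h <;>
      rcases fin_three_cases (i := i') (j := j) with h' | h' | h'
    · exact absurd (h.symm.trans h') hii
    · rwa [e0 i h, e1 i' h']
    · rwa [e0 i h, e2 i' h']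
    · rw [e1 i h, e0 i' h']
      exact a0.symm
    · exact absurd (add_right_cancel (h.symm.trans h')) hii
    · rwa [e1 i h, e2 i' h']
    · rw [e2 i h, e0 i' h']
      exact a1.symm
    · rw [e2 i h, e1 i' h']
      exact a2.symm
    · exact absurd (add_right_cancel (h.symm.trans h')) hii
  have hM : ∀ i, ∃ M, IsMatchingOf (E ∩ Fintype.piFinset (A i)) M ∧ #M = #(R i ∩ W i) := by
    intro i
    refine exists_matching_of_good_box (W := W) (j := i) (k := i + 1) ?_ (hAc i) (hlow i)
      (fun j v hv => hgood j v (hAR i j hv)) ?_ ?_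
    · have := hlow i
      omega
    · rw [hA0]
      exact inter_subset_right
    · rw [hA1]
      exact sdiff_disjoint.mono_left sdiff_subset
  choose M hM hMc using hM
  have hMR : ∀ i, IsMatchingOf (E ∩ Fintype.piFinset R) (M i) := fun i =>
    (hM i).mono (inter_subset_inter_left (Fintype.piFinset_subset _ _ (hAR i)))
  have hcross : ∀ i i', i ≠ i' → ∀ e ∈ M i, ∀ f ∈ M i', Disj e f := by
    intro i i' hii e he f hf j hef
    have h1 := Fintype.mem_piFinset.1 (mem_inter.1 ((hM i).1 he)).2 j
    have h2 := Fintype.mem_piFinset.1 (mem_inter.1 ((hM i').1 hf)).2 j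
    rw [hef] at h1
    exact Finset.disjoint_left.1 (hdisj i i' hii j) h1 h2
  obtain ⟨h1, c1⟩ := (hMR 0).union (hMR 1) (hcross 0 1 (by decide))
  obtain ⟨h2, c2⟩ := h1.union (hMR 2) (fun e he f hf => by
    rcases mem_union.1 he with he | he
    · exact hcross 0 2 (by decide) e he f hf
    · exact hcross 1 2 (by decide) e he f hf)
  refine ⟨_, h2, ?_⟩
  rw [c2, c1, hMc, hMc, hMc, ← hsum, Fin.sum_univ_three]

end

/-! ### Removing the surplus and absorbing the bad vertices -/

section

variable {V : Type*} [DecidableEq V]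

/-- The vertices of `R` that are not covered by `N`. -/
def rest (R : Fin 3 → Finset V) (N : Finset (Fin 3 → V)) (i : Fin 3) : Finset V :=
  R i \ N.image fun e => e i

theorem card_rest {E N : Finset (Fin 3 → V)} {R : Fin 3 → Finset V}
    (hN : IsMatchingOf (E ∩ Fintype.piFinset R) N) (i : Fin 3) :
    #(rest R N i) = #(R i) - #N := by
  rw [rest, card_sdiff_of_subset, hN.card_image]
  exact image_subset_iff.2 fun e he => Fintype.mem_piFinset.1 (mem_inter.1 (hN.1 he)).2 i

theorem IsMatchingOf.union_rest {E N N' : Finset (Fin 3 → V)} {R : Fin 3 → Finset V}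
    (hN : IsMatchingOf (E ∩ Fintype.piFinset R) N)
    (hN' : IsMatchingOf (E ∩ Fintype.piFinset (rest R N)) N') :
    IsMatchingOf (E ∩ Fintype.piFinset R) (N ∪ N') ∧ #(N ∪ N') = #N + #N' := by
  refine hN.union (hN'.mono (inter_subset_inter_left (Fintype.piFinset_subset _ _ fun i =>
    sdiff_subset))) fun e he f hf i hef => ?_
  have := Fintype.mem_piFinset.1 (mem_inter.1 (hN'.1 hf)).2 i
  exact (mem_sdiff.1 this).2 (mem_image.2 ⟨e, he, hef⟩)

variable [Fintype V]

/-- An edge with two vertices in `W` lowers the `W`-count by two and the class size by one, so `t`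
such edges remove a surplus of `t`. They are found in a good box with classes `0`, `1` inside `W`
and class `2` outside. -/
theorem exists_perfect_matching_of_good {W R : Fin 3 → Finset V} {E : Finset (Fin 3 → V)}
    {r t : ℕ} (hR : ∀ i, #(R i) = r) (hsum : ∑ i, #(R i ∩ W i) = r + t)
    (hn : 100 ≤ Fintype.card V) (hX : ∀ i, Fintype.card V ≤ 4 * #(R i ∩ W i))
    (hY : ∀ i, Fintype.card V ≤ 4 * #(R i \ W i)) (ht : 8 * t ≤ Fintype.card V)
    (hgood : ∀ i, ∀ v ∈ R i, IsGood W E i v) :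
    ∃ M, IsMatchingOf (E ∩ Fintype.piFinset R) M ∧ #M = r := by
  set n := Fintype.card V with hndef
  have hXsub : ∀ i, ∃ S ⊆ R i ∩ W i, #S = n / 8 + 1 := fun i =>
    exists_subset_card_eq (by have := hX i; omega)
  have hYsub : ∀ i, ∃ S ⊆ R i \ W i, #S = n / 8 + 1 := fun i =>
    exists_subset_card_eq (by have := hY i; omega)
  obtain ⟨A₀, h₀, c₀⟩ := hXsub 0
  obtain ⟨A₁, h₁, c₁⟩ := hXsub 1
  obtain ⟨A₂, h₂, c₂⟩ := hYsub 2
  set A : Fin 3 → Finset V := ![A₀, A₁, A₂] with hA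
  have hAR : ∀ i, A i ⊆ R i := forall_fin_three 0 (h₀.trans inter_subset_left)
    (h₁.trans inter_subset_left) (h₂.trans sdiff_subset)
  obtain ⟨N₀, hN₀, hN₀c⟩ := exists_matching_of_good_box (W := W) (E := E) (A := A)
    (w := n / 8 + 1) (by omega) (forall_fin_three 0 c₀ c₁ c₂) (by omega)
    (fun i v hv => hgood i v (hAR i hv)) (j := 0) (k := 2) (h₀.trans inter_subset_right)
    (sdiff_disjoint.mono_left h₂)
  obtain ⟨N, hNsub, hNc⟩ := exists_subset_card_eq (s := N₀) (n := t) (by omega)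
  have hNA := hN₀.subset hNsub
  have hN : IsMatchingOf (E ∩ Fintype.piFinset R) N :=
    hNA.mono (inter_subset_inter_left (Fintype.piFinset_subset _ _ hAR))
  have himg : ∀ i, (N.image fun e => e i) ⊆ A i := fun i => image_subset_iff.2 fun e he =>
    Fintype.mem_piFinset.1 (mem_inter.1 (hNA.1 he)).2 i
  have hrest : ∀ i, rest R N i ∩ W i = (R i ∩ W i) \ N.image fun e => e i := fun i => by
    rw [rest, sdiff_inter_right_comm]
  have hr0 : #(rest R N 0 ∩ W 0) = #(R 0 ∩ W 0) - t := by
    rw [hrest, card_sdiff_of_subset ((himg 0).trans h₀), hN.card_image, hNc]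
  have hr1 : #(rest R N 1 ∩ W 1) = #(R 1 ∩ W 1) - t := by
    rw [hrest, card_sdiff_of_subset ((himg 1).trans h₁), hN.card_image, hNc]
  have hr2 : #(rest R N 2 ∩ W 2) = #(R 2 ∩ W 2) := by
    rw [hrest, sdiff_eq_self_of_disjoint]
    exact (disjoint_sdiff_inter (R 2) (W 2)).symm.mono_right ((himg 2).trans h₂)
  have x0 := hX 0
  have x1 := hX 1
  have x2 := hX 2
  rw [Fin.sum_univ_three] at hsum
  obtain ⟨N', hN', hN'c⟩ := exists_perfect_matching_of_balanced (W := W) (R := rest R N) (E := E)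
    (r := r - t) (fun i => by rw [card_rest hN, hR, hNc])
    (by rw [Fin.sum_univ_three, hr0, hr1, hr2]; omega) (by omega)
    (forall_fin_three 0 (by omega) (by change n ≤ 8 * #(rest R N 1 ∩ W 1); omega)
      (by change n ≤ 8 * #(rest R N 2 ∩ W 2); omega))
    (fun i v hv => hgood i v (mem_sdiff.1 hv).1)
  obtain ⟨h, c⟩ := hN.union_rest hN'
  have htr : t ≤ r := by
    rw [← hR 0, ← hNc, ← hN.card_image 0]
    exact card_le_card ((himg 0).trans (hAR 0))
  exact ⟨_, h, by omega⟩

/-- Double counting of missing triples by their vertex in class `i`, with `2 ^ 22 = 4096 * 1024`. -/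
theorem four_thousand_mul_card_bad_le {W : Fin 3 → Finset V} {E : Finset (Fin 3 → V)}
    (hV : 0 < Fintype.card V) (hclose : 2 ^ 22 * #(missing W E) ≤ Fintype.card V ^ 3) (i : Fin 3) :
    4096 * #{v | ¬ IsGood W E i v} ≤ Fintype.card V := by
  set n := Fintype.card V
  set B : Finset V := {v | ¬ IsGood W E i v}
  have h1 : #B * n ^ 2 ≤ 1024 * #(missing W E) := by
    calc #B * n ^ 2 = ∑ _v ∈ B, n ^ 2 := by rw [sum_const, smul_eq_mul]
      _ ≤ ∑ v ∈ B, 1024 * #{e ∈ missing W E | e i = v} :=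
          sum_le_sum fun v hv => (not_le.1 (mem_filter.1 hv).2).le
      _ ≤ ∑ v, 1024 * #{e ∈ missing W E | e i = v} :=
          sum_le_sum_of_subset (subset_univ _)
      _ = 1024 * #(missing W E) := by
          rw [← mul_sum, ← card_eq_sum_card_fiberwise fun _ _ => mem_coe.2 (mem_univ _)]
  have h2 : (4096 * #B) * n ^ 2 ≤ n * n ^ 2 := by
    calc _ = 4096 * (#B * n ^ 2) := by ring
      _ ≤ 4096 * (1024 * #(missing W E)) := Nat.mul_le_mul_left _ h1
      _ = 2 ^ 22 * #(missing W E) := by ring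
      _ ≤ _ := hclose.trans_eq (by ring)
  exact Nat.le_of_mul_le_mul_right h2 (by positivity)

/-- With `X` the good part of `W`, the `s` edges avoiding `X` compensate for the `s` discarded
vertices, and later edges of weight at most one preserve that gain. -/
theorem exists_perfect_matching {n D : ℕ} (hV : Fintype.card V = n) (hn : 10000 ≤ n)
    (hD : Hypergraph.degreeThreshold n < D) {E : Finset (Fin 3 → V)}
    (hdeg : ∀ i v, D ≤ #{e ∈ E | e i = v}) {W : Fin 3 → Finset V}
    (hW : ∀ i, #(W i) = Hypergraph.equitableSizes n i)
    (hclose : 2 ^ 22 * #(missing W E) ≤ n ^ 3) : ∃ M, IsMatchingOf E M ∧ #M = n := by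
  set B : Fin 3 → Finset V := fun i => {v | ¬ IsGood W E i v} with hB
  have hBc : ∀ i, 4096 * #(B i) ≤ n := fun i => by
    have := four_thousand_mul_card_bad_le (W := W) (E := E) (by omega) (by rwa [hV]) i
    rwa [hV] at this
  have hWlow : ∀ i, n ≤ 3 * #(W i) + 2 := fun i => by
    rw [hW, Hypergraph.equitableSizes]
    omega
  have hWup : ∀ i, 3 * #(W i) ≤ n + 2 := fun i => by
    rw [hW, Hypergraph.equitableSizes]
    omega
  have hWsum : ∑ i, #(W i) = n := by
    rw [Fin.sum_univ_three, hW, hW, hW]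
    simp only [Hypergraph.equitableSizes, Fin.val_zero, Fin.val_one, Fin.val_two]
    omega
  set X : Fin 3 → Finset V := fun i => W i \ B i with hX
  have hXc : ∀ i, #(X i) + #(W i ∩ B i) = #(W i) := fun i => card_sdiff_add_card_inter _ _
  have hWB : ∀ i, #(W i ∩ B i) ≤ #(B i) := fun i => card_le_card inter_subset_right
  have hUc : ∀ i, #(X i)ᶜ = n - #(X i) := fun i => by rw [card_compl, hV]
  set s := ∑ i, #(W i ∩ B i) with hs
  have hs4 : 4096 * s ≤ 3 * n := by
    rw [hs, Fin.sum_univ_three]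
    have b0 := hBc 0
    have b1 := hBc 1
    have b2 := hBc 2
    have c0 := hWB 0
    have c1 := hWB 1
    have c2 := hWB 2
    omega
  have hXsum : ∑ i, #(X i) + s = n := by
    rw [hs, ← sum_add_distrib, ← hWsum]
    exact sum_congr rfl fun i _ => hXc i
  have hXW : ∀ i, #(X i) ≤ #(W i) := fun i => card_le_card sdiff_subset
  obtain ⟨M₁, hM₁, hM₁c⟩ := exists_matching_in_box hV (by omega) hD hdeg s (fun i => (X i)ᶜ) (by
    have a0 := hXW 0
    have a1 := hXW 1
    have a2 := hXW 2
    have b0 := hWup 0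
    have b1 := hWup 1
    have b2 := hWup 2
    rw [Fin.sum_univ_three] at hXsum ⊢
    simp only [hUc]
    omega) (fun i => by
      have := hXW i
      have := hWup i
      simp only [hUc]
      omega) (by omega)
  set wt : (Fin 3 → V) → ℕ := fun e => #{i | e i ∈ X i} with hwt
  set G : Finset (Fin 3 → V) := {e ∈ E | wt e ≤ 1} with hG
  have hM₁wt : ∀ e ∈ M₁, wt e = 0 := fun e he => by
    refine card_eq_zero.2 (filter_eq_empty_iff.2 fun i _ => ?_)
    exact mem_compl.1 (Fintype.mem_piFinset.1 (mem_inter.1 (hM₁.1 he)).2 i)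
  have hM₁G : IsMatchingOf G M₁ := ⟨fun e he => mem_filter.2
    ⟨(mem_inter.1 (hM₁.1 he)).1, by rw [hM₁wt e he]; exact zero_le_one⟩, hM₁.2⟩
  set S : Finset (Fin 3 × V) := {p | p.2 ∈ B p.1} with hS
  have hSc : #S = ∑ i, #(B i) := by
    rw [hS, card_filter, Fintype.sum_prod_type]
    refine sum_congr rfl fun i _ => ?_
    rw [← card_filter]
    simp
  have hS4 : 4096 * #S ≤ 3 * n := by
    rw [hSc, Fin.sum_univ_three]
    have b0 := hBc 0
    have b1 := hBc 1
    have b2 := hBc 2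
    omega
  -- A bad vertex is outside `X`, so only about `n ^ 2 / 9` triples through it have weight two,
  -- against about `5 n ^ 2 / 9` edges.
  have hdegG : ∀ p ∈ S, 2 * (#M₁ + #S) * Fintype.card V < #{e ∈ G | e p.1 = p.2} := by
    rintro ⟨i, v⟩ hp
    have hvB : v ∈ B i := (mem_filter.1 hp).2
    have hvX : v ∉ X i := fun h => (mem_sdiff.1 h).2 hvB
    have h1 : D ≤ #{e ∈ G | e i = v} + #(X (i + 1)) * #(X (i + 2)) := by
      have h2 : #{e ∈ Fintype.piFinset (Function.update X i {v}) | e i = v} =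
          #(X (i + 1)) * #(X (i + 2)) := by
        rw [card_slice _ (by rw [Function.update_self]; exact mem_singleton_self v),
          Function.update_of_ne (add_one_ne_self i), Function.update_of_ne (add_two_ne_self i)]
      rw [← h2]
      refine (hdeg i v).trans ((card_le_card ?_).trans (card_union_le _ _))
      intro e he
      rw [mem_filter] at he
      by_cases hmem : e (i + 1) ∈ X (i + 1) ∧ e (i + 2) ∈ X (i + 2)
      · refine mem_union_right _ (mem_filter.2 ⟨Fintype.mem_piFinset.2 ?_, he.2⟩)
        refine forall_fin_three i ?_ ?_ ?_
        · rw [Function.update_self, he.2]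
          exact mem_singleton_self v
        · rw [Function.update_of_ne (add_one_ne_self i)]
          exact hmem.1
        · rw [Function.update_of_ne (add_two_ne_self i)]
          exact hmem.2
      · refine mem_union_left _ (mem_filter.2 ⟨mem_filter.2 ⟨he.1, ?_⟩, he.2⟩)
        have : wt e = (if e i ∈ X i then 1 else 0) + (if e (i + 1) ∈ X (i + 1) then 1 else 0)
            + (if e (i + 2) ∈ X (i + 2) then 1 else 0) := by
          rw [hwt]
          simp only [card_filter]
          rw [sum_fin_three i]
        rw [this, he.2, if_neg hvX]
        split_ifs <;> simp_all
    have h3 : 9 * (#(X (i + 1)) * #(X (i + 2))) ≤ (n + 2) ^ 2 := by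
      have h4 : 3 * #(X (i + 1)) ≤ n + 2 := (Nat.mul_le_mul_left 3 (hXW _)).trans (hWup _)
      have h5 : 3 * #(X (i + 2)) ≤ n + 2 := (Nat.mul_le_mul_left 3 (hXW _)).trans (hWup _)
      nlinarith [Nat.mul_le_mul h4 h5]
    have h6 : 5 * n ^ 2 ≤ 9 * D + 8 * n := by
      obtain ⟨m, ⟨rfl, h⟩ | ⟨rfl, h⟩ | ⟨rfl, h⟩⟩ := lt_of_degreeThreshold_lt hD <;> linarith
    have h7 : 4096 * (2 * (#M₁ + #S) * n) ≤ 12 * n ^ 2 := by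
      have : 4096 * (#M₁ + #S) ≤ 6 * n := by omega
      nlinarith
    have h8 : 10000 * n ≤ n ^ 2 := by nlinarith
    have h9 : (n + 2) ^ 2 = n ^ 2 + 4 * n + 4 := by ring
    change 2 * (#M₁ + #S) * Fintype.card V < #{e ∈ G | e i = v}
    rw [hV]
    omega
  obtain ⟨M, hsub, hMG, hMc, hcov⟩ := hM₁G.exists_cover S hdegG
  have hME : IsMatchingOf (E ∩ Fintype.piFinset fun _ : Fin 3 => univ) M := by
    refine hMG.mono fun e he => mem_inter.2 ⟨(mem_filter.1 he).1, by simp⟩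
  set R : Fin 3 → Finset V := rest (fun _ => univ) M with hR
  have hRc : ∀ i, #(R i) = n - #M := fun i => by
    rw [hR, card_rest hME, card_univ, hV]
  have hwtsum : ∑ e ∈ M, wt e + s ≤ #M := by
    rw [← sum_sdiff hsub, sum_eq_zero hM₁wt, ← card_sdiff_add_card_eq_card hsub, hM₁c, add_zero]
    refine Nat.add_le_add_right ?_ _
    rw [card_eq_sum_ones]
    exact sum_le_sum fun e he => (mem_filter.1 (hMG.1 (mem_sdiff.1 he).1)).2
  have hwtsum' : ∑ e ∈ M, wt e = ∑ i, #{e ∈ M | e i ∈ X i} := by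
    simp only [hwt, card_filter]
    exact sum_comm
  have hXrest : ∀ i, #(X i) ≤ #(R i ∩ W i) + #{e ∈ M | e i ∈ X i} := by
    intro i
    have h1 : X i ⊆ (R i ∩ W i) ∪ ({e ∈ M | e i ∈ X i}.image fun e => e i) := by
      intro v hv
      by_cases hvM : ∃ e ∈ M, e i = v
      · obtain ⟨e, he, rfl⟩ := hvM
        exact mem_union_right _ (mem_image.2 ⟨e, mem_filter.2 ⟨he, hv⟩, rfl⟩)
      · refine mem_union_left _ (mem_inter.2 ⟨mem_sdiff.2 ⟨mem_univ _, ?_⟩, (mem_sdiff.1 hv).1⟩)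
        simpa using hvM
    refine (card_le_card h1).trans ((card_union_le _ _).trans ?_)
    exact Nat.add_le_add_left card_image_le _
  -- This bounds the surplus `t` by `#M`, while `hRWlow` makes the truncated subtraction defining
  -- `t` exact.
  have hRW : ∑ i, #(R i ∩ W i) ≤ n := hWsum ▸ sum_le_sum fun i _ =>
    card_le_card inter_subset_right
  have hRWlow : n - #M ≤ ∑ i, #(R i ∩ W i) := by
    have := sum_le_sum fun (i : Fin 3) (_ : i ∈ univ) => hXrest i
    rw [sum_add_distrib] at this
    omega
  have hWsplit : ∀ i, #(W i) ≤ #(R i ∩ W i) + #M := by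
    intro i
    have h1 : W i ⊆ (R i ∩ W i) ∪ M.image fun e => e i := by
      intro v hv
      by_cases hvM : v ∈ M.image fun e => e i
      · exact mem_union_right _ hvM
      · exact mem_union_left _ (mem_inter.2 ⟨mem_sdiff.2 ⟨mem_univ _, hvM⟩, hv⟩)
    exact (card_le_card h1).trans ((card_union_le _ _).trans
      (Nat.add_le_add_left card_image_le _))
  obtain ⟨N, hN, hNc⟩ := exists_perfect_matching_of_good (W := W) (R := R) (E := E)
    (r := n - #M) (t := ∑ i, #(R i ∩ W i) - (n - #M)) hRc (by omega) (by omega)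
    (fun i => by
      have := hWsplit i
      have := hWlow i
      omega)
    (fun i => by
      have := card_sdiff_add_card_inter (R i) (W i)
      have : #(R i ∩ W i) ≤ #(W i) := card_le_card inter_subset_right
      have := hWup i
      have := hRc i
      omega) (by omega)
    (fun i v hv => by
      by_contra hbad
      obtain ⟨e, he, hev⟩ := hcov (i, v) (mem_filter.2 ⟨mem_univ _, mem_filter.2
        ⟨mem_univ _, hbad⟩⟩)
      exact (mem_sdiff.1 hv).2 (mem_image.2 ⟨e, he, hev⟩))
  obtain ⟨h, c⟩ := hME.union_rest hN
  exact ⟨_, h.mono inter_subset_left, by omega⟩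

end

/-! ### From hypergraphs on sets to families of functions -/

section

variable {α V : Type*}

/-- The set of vertices of the transversal `e`, for a parametrization `φ i` of each class. -/
def toSet (φ : Fin 3 → V → α) (e : Fin 3 → V) : Set α := Set.range fun i => φ i (e i)

/-- The maps `φ i` parametrize the pairwise disjoint sets `P i`. -/
structure IsParametrization (P : Fin 3 → Set α) (φ : Fin 3 → V → α) : Prop where
  injective : ∀ i, Function.Injective (φ i)
  range_eq : ∀ i, Set.range (φ i) = P i
  disjoint : ∀ i j, i ≠ j → Disjoint (P i) (P j)

namespace IsParametrization

variable {P : Fin 3 → Set α} {φ : Fin 3 → V → α} (h : IsParametrization P φ)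

include h

theorem mem (i : Fin 3) (v : V) : φ i v ∈ P i := h.range_eq i ▸ Set.mem_range_self v

theorem eq_of_mem {i j : Fin 3} {v : V} (hv : φ i v ∈ P j) : i = j := by
  by_contra hij
  exact Set.disjoint_left.1 (h.disjoint i j hij) (h.mem i v) hv

theorem mem_toSet_iff {e : Fin 3 → V} {i : Fin 3} {v : V} : φ i v ∈ toSet φ e ↔ e i = v := by
  constructor
  · rintro ⟨j, hj⟩
    have hj' : φ j (e j) = φ i v := hj
    obtain rfl : j = i := h.eq_of_mem (hj' ▸ h.mem i v)
    exact h.injective j hj'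
  · rintro rfl
    exact ⟨i, rfl⟩

theorem toSet_injective : Function.Injective (toSet φ) := by
  intro e f hef
  funext i
  have : φ i (f i) ∈ toSet φ f := ⟨i, rfl⟩
  rw [← hef] at this
  exact h.mem_toSet_iff.1 this

theorem toSet_subset (e : Fin 3 → V) : toSet φ e ⊆ ⋃ i, P i := by
  rintro _ ⟨i, rfl⟩
  exact Set.mem_iUnion.2 ⟨i, h.mem i _⟩

theorem toSet_inter (e : Fin 3 → V) (i : Fin 3) : toSet φ e ∩ P i = {φ i (e i)} := by
  ext a
  constructor
  · rintro ⟨⟨j, rfl⟩, ha⟩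
    obtain rfl : j = i := h.eq_of_mem ha
    rfl
  · rintro rfl
    exact ⟨⟨i, rfl⟩, h.mem i _⟩

theorem exists_toSet_eq {x : Set α} (hx : x ⊆ ⋃ i, P i) (hc : ∀ i, (x ∩ P i).ncard = 1) :
    ∃ e, toSet φ e = x := by
  have hv : ∀ i, ∃ v, x ∩ P i = {φ i v} := by
    intro i
    obtain ⟨a, ha⟩ := Set.ncard_eq_one.1 (hc i)
    have haP : a ∈ x ∩ P i := ha ▸ Set.mem_singleton a
    obtain ⟨v, rfl⟩ : a ∈ Set.range (φ i) := h.range_eq i ▸ haP.2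
    exact ⟨v, ha⟩
  choose e he using hv
  refine ⟨e, Set.Subset.antisymm ?_ ?_⟩
  · rintro _ ⟨i, rfl⟩
    have : φ i (e i) ∈ x ∩ P i := he i ▸ Set.mem_singleton _
    exact this.1
  · intro a ha
    obtain ⟨i, hi⟩ := Set.mem_iUnion.1 (hx ha)
    have : a ∈ x ∩ P i := ⟨ha, hi⟩
    rw [he i] at this
    exact ⟨i, this.symm⟩

theorem disjoint_toSet {e f : Fin 3 → V} (hef : Disj e f) :
    Disjoint (toSet φ e) (toSet φ f) := by
  rw [Set.disjoint_left]
  rintro _ ⟨i, rfl⟩ hf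
  exact hef i (h.mem_toSet_iff.1 hf).symm

end IsParametrization

theorem exists_isParametrization {P : Fin 3 → Set α} {n : ℕ} (hn : n ≠ 0)
    (hP : ∀ i, (P i).ncard = n) (hd : ∀ i j, i ≠ j → Disjoint (P i) (P j)) :
    ∃ φ : Fin 3 → Fin n → α, IsParametrization P φ := by
  have hφ : ∀ i, ∃ f : Fin n → α, Function.Injective f ∧ Set.range f = P i := by
    intro i
    -- Infinite sets have `ncard` zero, so `n ≠ 0` is what gives finiteness.
    have : Finite (P i) := Set.finite_of_ncard_ne_zero (by rw [hP]; exact hn)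
    have e := (Finite.equivFinOfCardEq (show Nat.card (P i) = n from hP i)).symm
    exact ⟨fun v => e v, Subtype.val_injective.comp e.injective, by
      rw [show (fun v => (e v : α)) = Subtype.val ∘ e from rfl, e.surjective.range_comp,
        Subtype.range_coe]⟩
  choose φ h1 h2 using hφ
  exact ⟨φ, h1, h2, hd⟩

end

end TripartiteMatching

/-! ### Transfer to the original hypergraph -/

open TripartiteMatching Finset in
theorem mainTheorem5 :
    ∀ ε : ℝ, 0 < ε → ε < 2 ^ (-22 : ℤ) →
      ∃ n₀ : ℕ, ∀ n : ℕ, n₀ ≤ n →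
        ∀ (α : Type*) (H : Hypergraph α) (P : Fin 3 → Set α),
          H.IsKPartite P → (∀ i, (P i).ncard = n) →
          H.IsClose P n (Hypergraph.equitableSizes n) ε →
          Hypergraph.degreeThreshold n < (H.minVertexDegree : ℝ) →
          H.HasPerfectMatching := by
  classical
  intro ε _ hε
  refine ⟨10000, fun n hn α H P hP hPn hclose hD => ?_⟩
  obtain ⟨φ, h⟩ := exists_isParametrization (by omega) hPn hP.disjoint
  obtain ⟨W, hW, hWclose⟩ := hclose
  set E : Finset (Fin 3 → Fin n) := {e | toSet φ e ∈ H.edgeSet} with hE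
  set W' : Fin 3 → Finset (Fin n) := fun i => {v | φ i v ∈ W i} with hW'
  have hdeg : ∀ i v, H.minVertexDegree ≤ #{e ∈ E | e i = v} := by
    intro i v
    have hv : φ i v ∈ H.vertexSet := hP.iUnion_eq ▸ Set.mem_iUnion.2 ⟨i, h.mem i v⟩
    refine (Nat.sInf_le (Set.mem_image_of_mem _ hv)).trans_eq ?_
    have : {x ∈ H.edgeSet | φ i v ∈ x} = toSet φ '' ({e ∈ E | e i = v} : Finset _) := by
      ext x
      simp only [Set.mem_image, mem_coe, mem_filter, hE, mem_univ, true_and]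
      constructor
      · rintro ⟨hx, hvx⟩
        obtain ⟨e, rfl⟩ := h.exists_toSet_eq
          (hP.iUnion_eq ▸ H.subset_vertexSet_of_mem_edgeSet' hx) (hP.ncard_inter x hx)
        exact ⟨e, ⟨hx, h.mem_toSet_iff.1 hvx⟩, rfl⟩
      · rintro ⟨e, ⟨he, hev⟩, rfl⟩
        exact ⟨he, h.mem_toSet_iff.2 hev⟩
    rw [Hypergraph.vertexDegree, this, Set.ncard_image_of_injective _ h.toSet_injective,
      Set.ncard_coe_finset]
  have hW'c : ∀ i, #(W' i) = Hypergraph.equitableSizes n i := by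
    intro i
    have : W i = φ i '' (W' i : Set (Fin n)) := by
      ext a
      simp only [Set.mem_image, mem_coe, hW', mem_filter, mem_univ, true_and]
      constructor
      · intro ha
        obtain ⟨v, rfl⟩ : a ∈ Set.range (φ i) := h.range_eq i ▸ (hW i).1 ha
        exact ⟨v, ha, rfl⟩
      · rintro ⟨v, hv, rfl⟩
        exact hv
    rw [← (hW i).2, this, Set.ncard_image_of_injective _ (h.injective i), Set.ncard_coe_finset]
  have hWmem : ∀ (e : Fin 3 → Fin n) i, φ i (e i) ∈ ⋃ j, W j ↔ e i ∈ W' i := by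
    intro e i
    simp only [Set.mem_iUnion, hW', mem_filter, mem_univ, true_and]
    constructor
    · rintro ⟨j, hj⟩
      obtain rfl : i = j := h.eq_of_mem ((hW j).1 hj)
      exact hj
    · exact fun hi => ⟨i, hi⟩
  have hmissing : (Hypergraph.mixedTransversals P W).edgeSet \ H.edgeSet =
      toSet φ '' (missing W' E : Set (Fin 3 → Fin n)) := by
    have hmixed : ∀ e : Fin 3 → Fin n, (toSet φ e ∩ ⋃ j, W j).Nonempty ∧ ¬ toSet φ e ⊆ ⋃ j, W j ↔
        (∃ i, e i ∈ W' i) ∧ ∃ i, e i ∉ W' i := by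
      intro e
      refine and_congr ⟨?_, ?_⟩ ?_
      · rintro ⟨_, ⟨i, rfl⟩, ha⟩
        exact ⟨i, (hWmem e i).1 ha⟩
      · rintro ⟨i, hi⟩
        exact ⟨φ i (e i), ⟨i, rfl⟩, (hWmem e i).2 hi⟩
      · rw [toSet, Set.range_subset_iff, not_forall]
        exact exists_congr fun i => not_congr (hWmem e i)
    ext x
    simp only [Set.mem_image, mem_coe, missing, mem_filter, hE, mem_univ, true_and]
    constructor
    · rintro ⟨⟨hx, hc, hxW⟩, hxH⟩
      obtain ⟨e, rfl⟩ := h.exists_toSet_eq hx hc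
      exact ⟨e, ⟨(hmixed e).1 hxW, hxH⟩, rfl⟩
    · rintro ⟨e, ⟨heW, heH⟩, rfl⟩
      exact ⟨⟨h.toSet_subset e, fun i => by rw [h.toSet_inter, Set.ncard_singleton],
        (hmixed e).2 heW⟩, heH⟩
  have hclose' : 2 ^ 22 * #(missing W' E) ≤ n ^ 3 := by
    rw [hmissing, Set.ncard_image_of_injective _ h.toSet_injective, Set.ncard_coe_finset] at hWclose
    have h1 : ε * (n : ℝ) ^ 3 ≤ 2 ^ (-22 : ℤ) * (n : ℝ) ^ 3 := by gcongr
    have h2 : (2 : ℝ) ^ 22 * #(missing W' E) ≤ (n : ℝ) ^ 3 := by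
      have h3 : (2 : ℝ) ^ (-22 : ℤ) = 1 / 2 ^ 22 := by norm_num
      rw [h3] at h1
      linarith
    exact_mod_cast h2
  obtain ⟨M, hM, hMc⟩ := TripartiteMatching.exists_perfect_matching (Fintype.card_fin n) hn hD hdeg
    hW'c hclose'
  refine ⟨toSet φ '' M, ⟨?_, ?_⟩, ?_⟩
  · rintro _ ⟨e, he, rfl⟩
    exact (mem_filter.1 (hM.1 he)).2
  · rintro _ ⟨e, he, rfl⟩ _ ⟨f, hf, rfl⟩ hef
    exact h.disjoint_toSet (hM.2 e he f hf fun h' => hef (by rw [h']))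
  · rw [← hP.iUnion_eq]
    refine Set.Subset.antisymm ?_ ?_
    · rintro a ⟨_, ⟨e, -, rfl⟩, ha⟩
      exact h.toSet_subset e ha
    · intro a ha
      obtain ⟨i, hi⟩ := Set.mem_iUnion.1 ha
      obtain ⟨v, rfl⟩ : a ∈ Set.range (φ i) := h.range_eq i ▸ hi
      -- A matching of `n` edges has `n` distinct vertices in every class, so it covers everything.
      have himg : M.image (fun e => e i) = univ := by
        rw [← card_eq_iff_eq_univ, hM.card_image, hMc, Fintype.card_fin]
      obtain ⟨e, he, hev⟩ := mem_image.1 (himg ▸ mem_univ v)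
      exact ⟨toSet φ e, ⟨e, he, rfl⟩, h.mem_toSet_iff.2 hev⟩
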